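/- For an integer $n\ge 0$, let $Q_n$ be the $n$-dimensional hypercube: the graph whose vertices are the binary strings of length $n$, two strings being adjacent if and only if they differ in exactly one position (so $Q_0=K_1$). For a connected graph $G$ and a graph $W$, the $W$-structure connectivity $\kappa(G;W)$ is the least cardinality of a set of pairwise vertex-disjoint subgraphs of $G$, each isomorphic to $W$, such that deleting all their vertices from $G$ leaves a disconnected graph. The $W$-structure fault diameter $D_f(G;W)$ is the maximum diameter of a graph obtained from $G$ by deleting all vertices of at most $\kappa(G;W)-1$ pairwise vertex-disjoint subgraphs of $G$, each isomorphic to $W$; here the diameter of a graph is the maximum distance between two of its vertices. Theorem. Let $n\ge 3$ and $0\le m\le n-2$ be integers. Then $$D_f(Q_n;Q_m)=\begin{cases} n & \text{if } n=m+2,\\ n+1 & \text{if } n\ge m+3.\end{cases}$$ -/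

import Mathlib

namespace StructureFault

/-- The `n`-dimensional hypercube `Q_n`: the vertices are the binary strings of length `n`, and two
strings are adjacent iff they differ in exactly one position. -/
def hypercube (n : ℕ) : SimpleGraph (Fin n → Bool) where
  Adj x y := hammingDist x y = 1
  symm := ⟨fun x y h => by rw [hammingDist_comm]; exact h⟩
  loopless := ⟨fun x h => by simp at h⟩

variable {V U : Type*}

/-- `F` is a finite set of pairwise vertex-disjoint subgraphs of `G`, each of which (as a graph on
its own vertex set, not necessarily induced in `G`) is isomorphic to `W`. -/
def IsStructureFamily (G : SimpleGraph V) (W : SimpleGraph U) (F : Finset G.Subgraph) : Prop :=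
  (∀ H ∈ F, Nonempty (H.coe ≃g W)) ∧
    ∀ H ∈ F, ∀ K ∈ F, H ≠ K → Disjoint H.verts K.verts

/-- The graph that remains of `G` when all vertices of the members of `F` are deleted. -/
def remove (G : SimpleGraph V) (F : Finset G.Subgraph) :
    SimpleGraph {v : V | ∀ H ∈ F, v ∉ H.verts} :=
  G.induce {v : V | ∀ H ∈ F, v ∉ H.verts}

/-- The `W`-structure connectivity `κ(G; W)`: the least number of members of a set of pairwise
vertex-disjoint subgraphs isomorphic to `W` whose removal leaves a disconnected graph, i.e. one in
which some two remaining vertices are not joined by a path (`⊤` if there is no such set). -/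
noncomputable def structureConnectivity (G : SimpleGraph V) (W : SimpleGraph U) : ℕ∞ :=
  ⨅ (F : Finset G.Subgraph) (_ : IsStructureFamily G W F ∧ ¬ (remove G F).Preconnected),
    (F.card : ℕ∞)

/-- The `W`-structure fault diameter `D_f(G; W)`: the largest diameter of a graph obtained from `G`
by removing at most `κ(G; W) - 1` pairwise vertex-disjoint subgraphs isomorphic to `W`. Diameters
are `ℕ∞`-valued, so that a disconnected graph has diameter `⊤` and a finite value of the supremum
is a maximum. -/
noncomputable def structureFaultDiameter (G : SimpleGraph V) (W : SimpleGraph U) : ℕ∞ :=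
  ⨆ (F : Finset G.Subgraph)
    (_ : IsStructureFamily G W F ∧ (F.card : ℕ∞) + 1 ≤ structureConnectivity G W),
    (remove G F).ediam

end StructureFault

/-
Every copy of `Q_m` in `Q_n` occupies a subcube of codimension `n - m`, so the faults are fewer
than `n - m` subcubes, each with at least `n - m` fixed positions. Call a family of subcubes sparse
if each of its members has more fixed positions than the family has members. If the faults stay
sparse when restricted to the subcube spanned by two surviving strings, then some geodesic between
them survives, since a suitable step preserves sparsity: it takes at most one fixed position from
each fault, and if it takes one, then some fault is lost. Otherwise some fault is fixed at a
position where the two strings agree. If a fault lies on the opposite side of that position,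
restricting to the common side loses it; if not, both strings can cross to the opposite side, where
fewer faults remain. Each crossing costs two steps but makes the remaining faults sparser by one, so
strings that need `c` crossings agree in at least `2 * c - 1` positions and are joined by a path of
length at most `n - (2 * c - 1) + 2 * c = n + 1`. A single fault always leaves a geodesic.

For the lower bounds fix a set `S` of `n - m` positions. The subcubes obtained by fixing the entries
on `S`, exactly one of them to `1`, are disjoint copies of `Q_m` and separate the slice of strings
vanishing on `S` from the rest, so `κ(Q_n; Q_m) = n - m`. Leaving out the one with its `1` at `j`
forces every path from the zero string to the string with its only `0` at `j` to change position `j`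
and to change it back, a detour of two steps.
-/

namespace StructureFault

section Disagreement

variable {ι : Type*} [Fintype ι]

/-- The positions at which two strings differ. Its cardinality is, by definition, their
`hammingDist`. -/
def disagreement (x y : ι → Bool) : Finset ι :=
  {i | x i ≠ y i}

@[simp] theorem mem_disagreement {x y : ι → Bool} {i : ι} : i ∈ disagreement x y ↔ x i ≠ y i := by
  simp [disagreement]

theorem disagreement_comm (x y : ι → Bool) : disagreement x y = disagreement y x := by
  ext i
  simp only [mem_disagreement, ne_comm]

end Disagreement

section Toggle

variable {ι : Type*} [DecidableEq ι]

/-- The string obtained from `x` by changing position `i`. -/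
def toggle (x : ι → Bool) (i : ι) : ι → Bool :=
  Function.update x i (!x i)

@[simp] theorem toggle_same (x : ι → Bool) (i : ι) : toggle x i i = !x i := by
  simp [toggle]

theorem toggle_of_ne (x : ι → Bool) {i j : ι} (h : j ≠ i) : toggle x i j = x j := by
  simp [toggle, h]

@[simp] theorem toggle_toggle (x : ι → Bool) (i : ι) : toggle (toggle x i) i = x := by
  simp [toggle]

theorem toggle_comm (x : ι → Bool) (i j : ι) :
    toggle (toggle x i) j = toggle (toggle x j) i := by
  by_cases h : i = j
  · rw [h]
  · simp [toggle, Function.update_comm h, Function.update_of_ne h,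
      Function.update_of_ne (Ne.symm h)]

theorem toggle_injective (x : ι → Bool) : Function.Injective (toggle x) := by
  intro i j h
  by_contra hij
  simpa [toggle_of_ne x hij] using congrFun h i

theorem eq_of_toggle_toggle_eq {x : ι → Bool} {i j k l : ι}
    (h : toggle (toggle x i) k = toggle (toggle x j) l) (hij : i ≠ j) (hik : i ≠ k) : i = l := by
  by_contra hil
  simpa [toggle_of_ne _ hik, toggle_of_ne _ hij, toggle_of_ne _ hil] using congrFun h i

variable [Fintype ι]

theorem disagreement_toggle_of_ne {x y : ι → Bool} {i : ι} (h : x i ≠ y i) :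
    disagreement (toggle x i) y = (disagreement x y).erase i := by
  ext j
  rcases eq_or_ne j i with rfl | hj
  · simpa [Bool.eq_not] using h
  · simp [toggle_of_ne x hj, hj]

theorem disagreement_toggle_toggle {x y : ι → Bool} {i : ι} (h : x i = y i) :
    disagreement (toggle x i) (toggle y i) = disagreement x y := by
  ext j
  rcases eq_or_ne j i with rfl | hj
  · simp [h]
  · simp [toggle_of_ne _ hj]

theorem hammingDist_eq_one_iff_eq_toggle {x y : ι → Bool} :
    hammingDist x y = 1 ↔ ∃ i, y = toggle x i := by
  constructor
  · intro h
    obtain ⟨i, hi⟩ : ∃ i, disagreement x y = {i} := Finset.card_eq_one.1 h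
    have hxy : x i ≠ y i := by simp [← mem_disagreement, hi]
    have hdist : hammingDist (toggle x i) y = 0 := by
      change (disagreement (toggle x i) y).card = 0
      simp [disagreement_toggle_of_ne hxy, hi]
    exact ⟨i, (eq_of_hammingDist_eq_zero hdist).symm⟩
  · rintro ⟨i, rfl⟩
    refine Finset.card_eq_one.2 ⟨i, Finset.ext fun j => ?_⟩
    rcases eq_or_ne j i with rfl | hj
    · simp
    · simp [toggle_of_ne x hj, hj]

theorem hammingDist_toggle_add_one {x y : ι → Bool} {i : ι} (h : x i ≠ y i) :
    hammingDist (toggle x i) y + 1 = hammingDist x y := by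
  change (disagreement (toggle x i) y).card + 1 = (disagreement x y).card
  rw [disagreement_toggle_of_ne h, Finset.card_erase_add_one (mem_disagreement.2 h)]

theorem toggle_closed_induction {p : (ι → Bool) → Prop} {A : Finset ι}
    (hp : ∀ x, p x → ∀ i ∈ A, p (toggle x i)) {x y : ι → Bool} (hxy : disagreement x y ⊆ A)
    (hx : p x) : p y := by
  induction h : disagreement x y using Finset.induction generalizing x with
  | empty =>
    have : x = y := eq_of_hammingDist_eq_zero (Finset.card_eq_zero.2 h)
    exact this ▸ hx
  | insert i s hi ih =>
    have hmem : i ∈ disagreement x y := h ▸ Finset.mem_insert_self i s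
    have hd : disagreement (toggle x i) y = s := by
      rw [disagreement_toggle_of_ne (mem_disagreement.1 hmem), h, Finset.erase_insert hi]
    refine ih ?_ (hp x hx i (hxy hmem)) hd
    exact hd ▸ (Finset.subset_insert i s).trans (h ▸ hxy)

end Toggle

theorem hypercube_adj_iff {n : ℕ} {x y : Fin n → Bool} :
    (hypercube n).Adj x y ↔ ∃ i, y = toggle x i :=
  hammingDist_eq_one_iff_eq_toggle

theorem hypercube_adj_toggle {n : ℕ} (x : Fin n → Bool) (i : Fin n) :
    (hypercube n).Adj x (toggle x i) :=
  hypercube_adj_iff.2 ⟨i, rfl⟩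

/-- A subcube of the cube of all strings, given by the values at its fixed positions. The entries
of `value` outside `fixed` are irrelevant, so distinct terms may describe the same set of strings;
only upper bounds on the number of subcubes in a family are ever needed. -/
structure Subcube (ι : Type*) where
  /-- The positions at which all strings of the subcube have a prescribed value. -/
  fixed : Finset ι
  /-- The prescribed values. -/
  value : ι → Bool

section Subcube

variable {ι : Type*}

/-- The strings belonging to a subcube. -/
def Subcube.points (C : Subcube ι) : Set (ι → Bool) :=
  {x | ∀ i ∈ C.fixed, x i = C.value i}

/-- The strings outside all members of a family of subcubes: the vertices that survive its
deletion. -/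
def avoiding (F : Finset (Subcube ι)) : Set (ι → Bool) :=
  {x | ∀ C ∈ F, x ∉ C.points}

variable [DecidableEq ι]

theorem Subcube.fixed_of_toggle_mem {C : Subcube ι} {x : ι → Bool} {i : ι} (hx : x ∉ C.points)
    (hi : toggle x i ∈ C.points) : i ∈ C.fixed ∧ C.value i = !x i := by
  have hfixed : i ∈ C.fixed := by
    by_contra h
    refine hx fun j hj => ?_
    rw [← hi j hj, toggle_of_ne x (ne_of_mem_of_not_mem hj h)]
  exact ⟨hfixed, by rw [← hi i hfixed, toggle_same]⟩

theorem Subcube.eq_of_toggle_mem {C : Subcube ι} {x : ι → Bool} {i j : ι} (hx : x ∉ C.points)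
    (hi : toggle x i ∈ C.points) (hj : toggle x j ∈ C.points) : i = j := by
  by_contra hij
  obtain ⟨hfixed, hvalue⟩ := fixed_of_toggle_mem hx hi
  simpa [toggle_of_ne x hij, hvalue] using hj i hfixed

/-- The members of `F` that meet the slice of all strings agreeing with `x` outside `A`. -/
def meeting (F : Finset (Subcube ι)) (A : Finset ι) (x : ι → Bool) : Finset (Subcube ι) :=
  F.filter fun C => ∀ i ∈ C.fixed, i ∉ A → C.value i = x i

variable {F : Finset (Subcube ι)} {A B : Finset ι} {x y : ι → Bool} {i : ι} {k : ℕ}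

theorem meeting_subset : meeting F A x ⊆ F :=
  Finset.filter_subset _ _

theorem value_eq_of_mem_meeting {C : Subcube ι} (hC : C ∈ meeting F A x) (hi : i ∈ C.fixed)
    (hiA : i ∉ A) : C.value i = x i :=
  (Finset.mem_filter.1 hC).2 i hi hiA

theorem mem_meeting_of_mem_points {C : Subcube ι} (hC : C ∈ F) (hy : y ∈ C.points)
    (hyx : ∀ j ∉ A, y j = x j) : C ∈ meeting F A x :=
  Finset.mem_filter.2 ⟨hC, fun j hj hjA => by rw [← hy j hj, hyx j hjA]⟩

theorem meeting_mono (hBA : B ⊆ A) (hyx : ∀ j ∉ A, y j = x j) : meeting F B y ⊆ meeting F A x :=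
  Finset.monotone_filter_right F fun _ _ hC j hj hjA =>
    (hC j hj (fun hjB => hjA (hBA hjB))).trans (hyx j hjA)

theorem meeting_congr (hyx : ∀ j ∉ A, y j = x j) : meeting F A y = meeting F A x :=
  (meeting_mono subset_rfl hyx).antisymm (meeting_mono subset_rfl fun j hj => (hyx j hj).symm)

theorem card_meeting_erase_lt (hyx : ∀ j ∉ A, y j = x j) {C : Subcube ι}
    (hC : C ∈ meeting F A x) (hi : i ∈ C.fixed) (hne : C.value i ≠ y i) :
    (meeting F (A.erase i) y).card < (meeting F A x).card := by
  refine Finset.card_lt_card ((Finset.ssubset_iff_of_subset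
    (meeting_mono (Finset.erase_subset i A) hyx)).2 ⟨C, hC, fun hC' => ?_⟩)
  exact hne (value_eq_of_mem_meeting hC' hi (Finset.notMem_erase i A))

theorem toggle_eq_off (hi : i ∈ A) : ∀ j ∉ A, toggle x i j = x j :=
  fun _ hj => toggle_of_ne x (ne_of_mem_of_not_mem hi hj).symm

/-- In the slice of all strings agreeing with `x` outside `A`, each subcube of `F` that meets the
slice has codimension more than `k` plus the number of such subcubes. -/
def Sparse (k : ℕ) (F : Finset (Subcube ι)) (A : Finset ι) (x : ι → Bool) : Prop :=
  ∀ C ∈ meeting F A x, (meeting F A x).card + k < (C.fixed ∩ A).card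

theorem Sparse.congr (h : Sparse k F A x) (hyx : ∀ j ∉ A, y j = x j) : Sparse k F A y := by
  rwa [Sparse, meeting_congr hyx]

/-- Halving a slice costs at most one codimension, which is paid for by a lost subcube. -/
theorem Sparse.erase (h : Sparse k F A x) (hyx : ∀ j ∉ A, y j = x j) {C : Subcube ι}
    (hC : C ∈ meeting F A x) (hi : i ∈ C.fixed) (hne : C.value i ≠ y i) :
    Sparse k F (A.erase i) y := by
  intro C' hC'
  have hlt := card_meeting_erase_lt hyx hC hi hne
  have hsparse := h C' (meeting_mono (Finset.erase_subset i A) hyx hC')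
  have hpred := Finset.pred_card_le_card_erase (s := C'.fixed ∩ A) (a := i)
  rw [Finset.inter_erase]
  omega

theorem Sparse.erase_of_forall_notMem {l : ℕ} (h : Sparse k F A x) (hyx : ∀ j ∉ A, y j = x j)
    (hfree : ∀ C ∈ meeting F (A.erase i) y, i ∉ C.fixed)
    (hcard : (meeting F (A.erase i) y).card + l ≤ (meeting F A x).card + k) :
    Sparse l F (A.erase i) y := by
  intro C hC
  rw [Finset.inter_erase, Finset.erase_eq_of_notMem fun hi => hfree C hC (Finset.mem_inter.1 hi).1]
  exact hcard.trans_lt (h C (meeting_mono (Finset.erase_subset i A) hyx hC))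

theorem Sparse.toggle_of_forall_value_eq (h : Sparse k F A x) (hi : i ∈ A)
    (hvalue : ∀ C ∈ meeting F A x, i ∈ C.fixed → C.value i = x i) {C : Subcube ι}
    (hC : C ∈ meeting F A x) (hiC : i ∈ C.fixed) : Sparse (k + 1) F (A.erase i) (toggle x i) := by
  have hlost : (meeting F (A.erase i) (toggle x i)).card < (meeting F A x).card :=
    card_meeting_erase_lt (toggle_eq_off hi) hC hiC (by simp [hvalue C hC hiC])
  refine h.erase_of_forall_notMem (toggle_eq_off hi) (fun C' hC' hiC' => ?_) (by omega)
  have hopposite := value_eq_of_mem_meeting hC' hiC' (Finset.notMem_erase i A)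
  have hsame := hvalue C' (meeting_mono (Finset.erase_subset i A) (toggle_eq_off hi) hC') hiC'
  simp [hsame] at hopposite

theorem toggle_mem_avoiding (hx : x ∈ avoiding F) (hi : i ∈ A)
    (hvalue : ∀ C ∈ meeting F A x, i ∈ C.fixed → C.value i = x i) : toggle x i ∈ avoiding F := by
  intro C hC hmem
  obtain ⟨hfixed, hne⟩ := Subcube.fixed_of_toggle_mem (hx C hC) hmem
  have := hvalue C (mem_meeting_of_mem_points hC hmem (toggle_eq_off hi)) hfixed
  simp [hne] at this

/-- Distinct toggles of `x` cannot land in the same subcube. -/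
theorem exists_toggle_mem_avoiding (hx : x ∈ avoiding F)
    (hcard : (meeting F A x).card < A.card) : ∃ i ∈ A, toggle x i ∈ avoiding F := by
  by_contra! hblocked
  have hhit : ∀ i ∈ A, ∃ C ∈ F, toggle x i ∈ C.points := fun i hi => by
    simpa [avoiding] using hblocked i hi
  have : Nonempty (Subcube ι) := ⟨⟨∅, x⟩⟩
  choose! c hcF hc using hhit
  refine hcard.not_ge (Finset.card_le_card_of_injOn c (fun i hi => ?_) fun i hi j hj hij => ?_)
  · exact mem_meeting_of_mem_points (hcF i hi) (hc i hi) (toggle_eq_off hi)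
  · exact Subcube.eq_of_toggle_mem (hx _ (hcF i hi)) (hc i hi) (hij ▸ hc j hj)

/-- A direction in which `x` is not blocked works for `x`, unless no subcube is lost on the side of
`x`; then either no subcube is fixed there at all, or `y` can move instead. -/
theorem Sparse.exists_toggle (h : Sparse k F A x) (hA : A.Nonempty) (hx : x ∈ avoiding F)
    (hy : y ∈ avoiding F) (hon : ∀ i ∈ A, x i ≠ y i) (hoff : ∀ i ∉ A, y i = x i) :
    ∃ i ∈ A, (toggle x i ∈ avoiding F ∧ Sparse k F (A.erase i) (toggle x i)) ∨
      (toggle y i ∈ avoiding F ∧ Sparse k F (A.erase i) (toggle y i)) := by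
  have hcard : (meeting F A x).card < A.card := by
    rcases (meeting F A x).eq_empty_or_nonempty with hM | ⟨C, hC⟩
    · simpa [hM] using hA
    · have := (h C hC).trans_le (Finset.card_le_card Finset.inter_subset_right)
      omega
  obtain ⟨i, hi, hxi⟩ := exists_toggle_mem_avoiding hx hcard
  refine ⟨i, hi, ?_⟩
  by_cases hsame : ∃ C ∈ meeting F A x, i ∈ C.fixed ∧ C.value i = x i
  · obtain ⟨C, hC, hiC, hCx⟩ := hsame
    exact .inl ⟨hxi, h.erase (toggle_eq_off hi) hC hiC (by simp [hCx])⟩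
  have hvalue : ∀ C ∈ meeting F A x, i ∈ C.fixed → C.value i = y i := fun C hC hiC => by
    have hCx : C.value i ≠ x i := fun hCx => hsame ⟨C, hC, hiC, hCx⟩
    rw [Bool.eq_not.2 hCx, Bool.eq_not.2 (hon i hi).symm]
  by_cases hfixed : ∃ C ∈ meeting F A x, i ∈ C.fixed
  · obtain ⟨C, hC, hiC⟩ := hfixed
    rw [← meeting_congr hoff] at hC hvalue
    exact .inr ⟨toggle_mem_avoiding hy hi hvalue,
      (h.congr hoff).erase (toggle_eq_off hi) hC hiC (by simp [hvalue C hC hiC])⟩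
  · have hsub := meeting_mono (F := F) (Finset.erase_subset i A) (toggle_eq_off (x := x) hi)
    exact .inl ⟨hxi, h.erase_of_forall_notMem (toggle_eq_off hi)
      (fun C hC hiC => hfixed ⟨C, hsub hC, hiC⟩)
      (Nat.add_le_add_right (Finset.card_le_card hsub) k)⟩

theorem sparse_zero_disagreement_of_card_le_one [Fintype ι] (hF : F.card ≤ 1)
    (hx : x ∈ avoiding F) (hy : y ∈ avoiding F) : Sparse 0 F (disagreement x y) x := by
  intro C hC
  have escape : ∀ z ∈ avoiding F, (∀ i ∉ disagreement x y, z i = x i) →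
      ∃ i ∈ C.fixed ∩ disagreement x y, z i ≠ C.value i := by
    intro z hz hzx
    by_contra! hagree
    refine hz C (meeting_subset hC) fun i hi => ?_
    by_cases hiD : i ∈ disagreement x y
    · exact hagree i (Finset.mem_inter.2 ⟨hi, hiD⟩)
    · rw [hzx i hiD, value_eq_of_mem_meeting hC hi hiD]
  obtain ⟨i, hi, hxi⟩ := escape x hx fun _ _ => rfl
  obtain ⟨j, hj, hyj⟩ := escape y hy fun i hi => by simpa [eq_comm] using hi
  refine ((Finset.card_le_card meeting_subset).trans hF).trans_lt
    (Finset.one_lt_card.2 ⟨i, hi, j, hj, ?_⟩)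
  rintro rfl
  have hxy := mem_disagreement.1 (Finset.mem_inter.1 hi).2
  exact hxy ((Bool.eq_not.2 hxi).trans (Bool.eq_not.2 hyj).symm)

end Subcube

section Distance

variable {n : ℕ} {F : Finset (Subcube (Fin n))}

/-- The hypercube with all vertices of the subcubes in `F` deleted. -/
abbrev avoidingGraph (F : Finset (Subcube (Fin n))) : SimpleGraph (avoiding F) :=
  (hypercube n).induce (avoiding F)

theorem edist_toggle_le_one {x : Fin n → Bool} {i : Fin n} (hx : x ∈ avoiding F)
    (hxi : toggle x i ∈ avoiding F) : (avoidingGraph F).edist ⟨x, hx⟩ ⟨toggle x i, hxi⟩ ≤ 1 :=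
  SimpleGraph.edist_le_one_iff_adj_or_eq.2 (.inl (hypercube_adj_toggle x i))

theorem edist_le_hammingDist_of_sparse (x y : avoiding F)
    (h : Sparse 0 F (disagreement x.1 y.1) x.1) :
    (avoidingGraph F).edist x y ≤ hammingDist x.1 y.1 := by
  induction hd : hammingDist x.1 y.1 generalizing x y with
  | zero =>
    obtain rfl : x = y := Subtype.ext (eq_of_hammingDist_eq_zero hd)
    simp
  | succ d ih =>
    have step : ∀ (x y : avoiding F) (i : Fin n) (_ : toggle x.1 i ∈ avoiding F),
        i ∈ disagreement x.1 y.1 → Sparse 0 F ((disagreement x.1 y.1).erase i) (toggle x.1 i) →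
        hammingDist x.1 y.1 = d + 1 → (avoidingGraph F).edist x y ≤ (d + 1 : ℕ) := by
      intro x y i hxi hi hsparse hd
      rw [mem_disagreement] at hi
      rw [← disagreement_toggle_of_ne hi] at hsparse
      have hrest := ih ⟨_, hxi⟩ y hsparse
        (Nat.succ_injective ((hammingDist_toggle_add_one hi).trans hd))
      calc (avoidingGraph F).edist x y
          ≤ (avoidingGraph F).edist x ⟨_, hxi⟩ + (avoidingGraph F).edist ⟨_, hxi⟩ y :=
            SimpleGraph.edist_triangle
        _ ≤ 1 + d := add_le_add (edist_toggle_le_one x.2 hxi) hrest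
        _ = (d + 1 : ℕ) := by push_cast; rw [add_comm]
    have hne : (disagreement x.1 y.1).Nonempty := Finset.card_pos.1 (d.succ_pos.trans_eq hd.symm)
    obtain ⟨i, hi, ⟨hmem, hsparse⟩ | ⟨hmem, hsparse⟩⟩ := h.exists_toggle hne x.2 y.2
      (fun i hi => mem_disagreement.1 hi) (fun i hi => by simpa [eq_comm] using hi)
    · exact step x y i hmem hi hsparse hd
    · rw [disagreement_comm] at hi hsparse
      rw [SimpleGraph.edist_comm]
      exact step y x i hmem hi hsparse (hammingDist_comm x.1 y.1 ▸ hd)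

theorem Sparse.exists_fixed_of_not_sparse_disagreement {k : ℕ} {A : Finset (Fin n)}
    {x y : Fin n → Bool} (h : Sparse k F A x) (hxy : disagreement x y ⊆ A)
    (hnot : ¬ Sparse 0 F (disagreement x y) x) :
    (disagreement x y).card + k < A.card ∧
      ∃ C ∈ meeting F A x, ∃ i ∈ C.fixed, i ∈ A ∧ x i = y i := by
  simp only [Sparse, add_zero, not_forall, not_lt] at hnot
  obtain ⟨C, hCD, hle⟩ := hnot
  have hsub := meeting_mono (F := F) (y := x) (x := x) hxy fun _ _ => rfl
  have hsparse := h C (hsub hCD)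
  have hM := Finset.card_le_card hsub
  have hsplit : (C.fixed ∩ disagreement x y).card + (C.fixed ∩ (A \ disagreement x y)).card =
      (C.fixed ∩ A).card := by
    rw [← Finset.card_union_of_disjoint (Finset.disjoint_sdiff.mono Finset.inter_subset_right
      Finset.inter_subset_right), ← Finset.inter_union_distrib_left,
      Finset.union_sdiff_of_subset hxy]
  have hcommon : (C.fixed ∩ (A \ disagreement x y)).card ≤ A.card - (disagreement x y).card :=
    (Finset.card_le_card Finset.inter_subset_right).trans (Finset.card_sdiff_of_subset hxy).le
  refine ⟨by omega, C, hsub hCD, ?_⟩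
  obtain ⟨i, hi⟩ : (C.fixed ∩ (A \ disagreement x y)).Nonempty := Finset.card_pos.1 (by omega)
  obtain ⟨hiC, hiA⟩ := Finset.mem_inter.1 hi
  exact ⟨i, hiC, (Finset.mem_sdiff.1 hiA).1, by simpa using (Finset.mem_sdiff.1 hiA).2⟩

theorem edist_le_add_two {x y : avoiding F} {i : Fin n} (hxi : toggle x.1 i ∈ avoiding F)
    (hyi : toggle y.1 i ∈ avoiding F) :
    (avoidingGraph F).edist x y ≤ (avoidingGraph F).edist ⟨_, hxi⟩ ⟨_, hyi⟩ + 2 :=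
  calc (avoidingGraph F).edist x y
      ≤ (avoidingGraph F).edist x ⟨_, hxi⟩ + ((avoidingGraph F).edist ⟨_, hxi⟩ ⟨_, hyi⟩ +
          (avoidingGraph F).edist ⟨_, hyi⟩ y) :=
        SimpleGraph.edist_triangle.trans (add_le_add_right SimpleGraph.edist_triangle _)
    _ ≤ 1 + ((avoidingGraph F).edist ⟨_, hxi⟩ ⟨_, hyi⟩ + 1) :=
        add_le_add (edist_toggle_le_one x.2 hxi) (add_le_add_right
          (SimpleGraph.edist_comm.trans_le (edist_toggle_le_one y.2 hyi)) _)
    _ = (avoidingGraph F).edist ⟨_, hxi⟩ ⟨_, hyi⟩ + 2 := by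
        rw [add_left_comm, one_add_one_eq_two]

/-- The slack `k` is what lets the induction close: moving both strings across a common position
costs two steps, but it loses a dimension and increases the slack by one. -/
theorem edist_le_of_sparse {k L : ℕ} {A : Finset (Fin n)} (x y : avoiding F)
    (h : Sparse k F A x.1) (hxy : disagreement x.1 y.1 ⊆ A) (hd : hammingDist x.1 y.1 ≤ L)
    (hL : A.card + 1 ≤ L + k) : (avoidingGraph F).edist x y ≤ L := by
  induction A using Finset.strongInduction generalizing x y k L with
  | _ A ih =>
  by_cases hgeo : Sparse 0 F (disagreement x.1 y.1) x.1
  · exact (edist_le_hammingDist_of_sparse x y hgeo).trans (by exact_mod_cast hd)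
  obtain ⟨hcard, C, hC, i, hiC, hi, hxyi⟩ := h.exists_fixed_of_not_sparse_disagreement hxy hgeo
  have hxy' : disagreement x.1 y.1 ⊆ A.erase i :=
    Finset.subset_erase.2 ⟨hxy, by simpa using hxyi⟩
  have hA := Finset.card_erase_add_one hi
  by_cases hopp : ∃ C ∈ meeting F A x.1, i ∈ C.fixed ∧ C.value i ≠ x.1 i
  · obtain ⟨C', hC', hiC', hne⟩ := hopp
    exact ih _ (Finset.erase_ssubset hi) x y (h.erase (fun _ _ => rfl) hC' hiC' hne) hxy' hd
      (by omega)
  have hvalue : ∀ C ∈ meeting F A x.1, i ∈ C.fixed → C.value i = x.1 i := fun C hC hiC => by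
    by_contra hne
    exact hopp ⟨C, hC, hiC, hne⟩
  have hxi : toggle x.1 i ∈ avoiding F := toggle_mem_avoiding x.2 hi hvalue
  have hyi : toggle y.1 i ∈ avoiding F := by
    have hyx : ∀ j ∉ A, y.1 j = x.1 j := fun j hj => by
      simpa [eq_comm] using fun hjD => hj (hxy hjD)
    exact toggle_mem_avoiding y.2 hi (by rwa [meeting_congr hyx, ← hxyi])
  have hD := disagreement_toggle_toggle hxyi
  have hdist : hammingDist (toggle x.1 i) (toggle y.1 i) = (disagreement x.1 y.1).card :=
    congrArg Finset.card hD
  obtain ⟨L, rfl⟩ : ∃ L', L = L' + 2 := Nat.exists_eq_add_of_le' (by omega)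
  have hrec := ih _ (Finset.erase_ssubset hi) (k := k + 1) (L := L) ⟨_, hxi⟩ ⟨_, hyi⟩
    (h.toggle_of_forall_value_eq hi hvalue hC hiC) (hD ▸ hxy')
    (hdist.trans_le (by omega)) (by omega)
  exact (edist_le_add_two hxi hyi).trans (by push_cast; gcongr)

theorem ediam_avoidingGraph_le_succ (h : ∀ C ∈ F, F.card < C.fixed.card) :
    (avoidingGraph F).ediam ≤ (n + 1 : ℕ) := by
  refine SimpleGraph.ediam_le_of_edist_le fun x y =>
    edist_le_of_sparse (k := 0) (A := Finset.univ) x y (fun C hC => ?_) (Finset.subset_univ _)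
      (hammingDist_le_card_fintype.trans (by simp)) (by simp)
  rw [Finset.inter_univ]
  exact (Finset.card_le_card meeting_subset).trans_lt (h C (meeting_subset hC))

theorem ediam_avoidingGraph_le_of_card_le_one (h : F.card ≤ 1) : (avoidingGraph F).ediam ≤ n := by
  refine SimpleGraph.ediam_le_of_edist_le fun x y => ?_
  calc (avoidingGraph F).edist x y
      ≤ hammingDist x.1 y.1 := edist_le_hammingDist_of_sparse x y
        (sparse_zero_disagreement_of_card_le_one h x.2 y.2)
    _ ≤ n := by exact_mod_cast hammingDist_le_card_fintype.trans (by simp)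

end Distance

section Embedding

variable {n m : ℕ} {f : (Fin m → Bool) → Fin n → Bool}

/-- Opposite edges of a square are mapped to edges of the same direction, so the direction of the
image of an edge depends on the direction of that edge only. -/
theorem exists_map_toggle_eq (hf : Function.Injective f)
    (hadj : ∀ x y, (hypercube m).Adj x y → (hypercube n).Adj (f x) (f y)) :
    ∃ d : Fin m → Fin n, ∀ x i, f (toggle x i) = toggle (f x) (d i) := by
  choose d hd using fun x i => hypercube_adj_iff.1 (hadj _ _ (hypercube_adj_toggle x i))
  have hconst : ∀ x i j, d x i = d (toggle x j) i := by
    intro x i j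
    rcases eq_or_ne i j with rfl | hij
    · have hback := hd (toggle x i) i
      rw [toggle_toggle, hd x i] at hback
      exact toggle_injective (toggle (f x) (d x i)) ((toggle_toggle _ _).trans hback)
    · have hsquare : toggle (toggle (f x) (d x i)) (d (toggle x i) j) =
          toggle (toggle (f x) (d x j)) (d (toggle x j) i) := by
        rw [← hd, ← hd, ← hd, ← hd, toggle_comm]
      have hdirs : d x i ≠ d x j := fun h =>
        hij (toggle_injective x (hf (by rw [hd, hd, h])))
      have hdiag : d x i ≠ d (toggle x i) j := fun h => by
        have hreturn : toggle (toggle x i) j = x := hf (by rw [hd, hd, ← h, toggle_toggle])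
        simpa [toggle_of_ne _ hij] using congrFun hreturn i
      exact eq_of_toggle_toggle_eq hsquare hdirs hdiag
  refine ⟨d fun _ => false, fun x i => ?_⟩
  have hx : d x i = d (fun _ => false) i :=
    toggle_closed_induction (p := fun y => d y i = d (fun _ => false) i) (A := Finset.univ)
      (fun y hy j _ => (hconst y i j).symm.trans hy) (Finset.subset_univ _) rfl
  rw [hd, hx]

theorem exists_range_eq_points (hf : Function.Injective f)
    (hadj : ∀ x y, (hypercube m).Adj x y → (hypercube n).Adj (f x) (f y)) :
    ∃ C : Subcube (Fin n), n ≤ C.fixed.card + m ∧ Set.range f = C.points := by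
  obtain ⟨d, hd⟩ := exists_map_toggle_eq hf hadj
  let D : Finset (Fin n) := Finset.univ.image d
  let o : Fin m → Bool := fun _ => false
  refine ⟨⟨Dᶜ, f o⟩, ?_, Set.Subset.antisymm ?_ fun y hy => ?_⟩
  · have hD : D.card ≤ m := Finset.card_image_le.trans (by simp)
    have := Finset.card_add_card_compl D
    rw [Fintype.card_fin] at this
    simp only
    omega
  · rintro _ ⟨x, rfl⟩
    refine toggle_closed_induction (p := fun x => f x ∈ Subcube.points ⟨Dᶜ, f o⟩)
      (A := Finset.univ) (fun x hx i _ => ?_) (Finset.subset_univ (disagreement o x)) fun _ _ => rfl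
    intro j hj
    have hji : j ≠ d i := fun h => Finset.mem_compl.1 hj
      (h ▸ Finset.mem_image_of_mem d (Finset.mem_univ i))
    rw [hd, toggle_of_ne _ hji, hx j hj]
  · refine toggle_closed_induction (p := (· ∈ Set.range f)) (A := D) ?_ (x := f o)
      (fun j hj => ?_) ⟨o, rfl⟩
    · rintro _ ⟨x, rfl⟩ j hj
      obtain ⟨i, -, rfl⟩ := Finset.mem_image.1 hj
      exact ⟨toggle x i, hd x i⟩
    · by_contra hjD
      exact mem_disagreement.1 hj (hy j (Finset.mem_compl.2 hjD)).symm

theorem exists_verts_eq_points {H : (hypercube n).Subgraph}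
    (hH : Nonempty (H.coe ≃g hypercube m)) :
    ∃ C : Subcube (Fin n), n ≤ C.fixed.card + m ∧ H.verts = C.points := by
  obtain ⟨e⟩ := hH
  obtain ⟨C, hC, hrange⟩ := exists_range_eq_points (f := fun x => (e.symm x).1)
    (Subtype.val_injective.comp e.symm.injective)
    (fun x y hxy => H.adj_sub (e.symm.map_adj_iff.2 hxy))
  refine ⟨C, hC, ?_⟩
  rw [← hrange, ← Function.comp_def, e.symm.surjective.range_comp, Subtype.range_coe]

theorem exists_subcubes_of_forall_iso {F : Finset (hypercube n).Subgraph}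
    (hF : ∀ H ∈ F, Nonempty (H.coe ≃g hypercube m)) :
    ∃ K : Finset (Subcube (Fin n)), K.card ≤ F.card ∧ (∀ C ∈ K, n ≤ C.fixed.card + m) ∧
      {x | ∀ H ∈ F, x ∉ H.verts} = avoiding K := by
  classical
  have : Nonempty (Subcube (Fin n)) := ⟨⟨∅, fun _ => false⟩⟩
  choose! c hc hcv using fun H hH => exists_verts_eq_points (hF H hH)
  refine ⟨F.image c, Finset.card_image_le, by simpa using hc, Set.ext fun x => ?_⟩
  simp only [avoiding, Set.mem_ofPred_eq, Finset.forall_mem_image]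
  exact forall₂_congr fun H hH => by rw [hcv H hH]

theorem ediam_remove_le_succ {F : Finset (hypercube n).Subgraph}
    (hF : ∀ H ∈ F, Nonempty (H.coe ≃g hypercube m)) (hcard : F.card + m < n) :
    (remove (hypercube n) F).ediam ≤ (n + 1 : ℕ) := by
  obtain ⟨K, hKF, hKfixed, hK⟩ := exists_subcubes_of_forall_iso hF
  rw [remove, hK]
  refine ediam_avoidingGraph_le_succ fun C hC => ?_
  have := hKfixed C hC
  omega

theorem ediam_remove_le_of_card_le_one {F : Finset (hypercube n).Subgraph}
    (hF : ∀ H ∈ F, Nonempty (H.coe ≃g hypercube m)) (hcard : F.card ≤ 1) :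
    (remove (hypercube n) F).ediam ≤ n := by
  obtain ⟨K, hKF, -, hK⟩ := exists_subcubes_of_forall_iso hF
  rw [remove, hK]
  exact ediam_avoidingGraph_le_of_card_le_one (hKF.trans hcard)

end Embedding

section NeighborCubes

variable {n m : ℕ}

/-- The subgraph of the hypercube induced on a subcube. -/
def Subcube.subgraph (C : Subcube (Fin n)) : (hypercube n).Subgraph :=
  (⊤ : (hypercube n).Subgraph).induce C.points

theorem hammingDist_comp_embedding {ι κ : Type*} [Fintype ι] [Fintype κ] (e : κ ↪ ι)
    {x y : ι → Bool} (h : ∀ i ∉ Set.range e, x i = y i) :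
    hammingDist (x ∘ e) (y ∘ e) = hammingDist x y := by
  refine (Finset.card_map e).symm.trans (congrArg Finset.card (Finset.ext fun i => ?_))
  simp only [Finset.mem_map, Finset.mem_filter, Finset.mem_univ, true_and, Function.comp_apply]
  refine ⟨fun ⟨_, hj, hji⟩ => hji ▸ hj, fun hi => ?_⟩
  obtain ⟨j, rfl⟩ : i ∈ Set.range e := by
    by_contra hrange
    exact hi (h i hrange)
  exact ⟨j, hi, rfl⟩

theorem Subcube.nonempty_iso (C : Subcube (Fin n)) (hC : C.fixed.card + m = n) :
    Nonempty (C.subgraph.coe ≃g hypercube m) := by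
  obtain ⟨e⟩ : Nonempty (Fin m ≃ {i // i ∉ C.fixed}) :=
    ⟨Fintype.equivOfCardEq (by simp [Fintype.card_subtype_compl]; omega)⟩
  let φ : Fin m ↪ Fin n := e.toEmbedding.trans (Function.Embedding.subtype _)
  have hφ : ∀ i ∉ Set.range φ, i ∈ C.fixed := fun i hi => by
    by_contra hiC
    exact hi ⟨e.symm ⟨i, hiC⟩, by simp [φ]⟩
  let extend (y : Fin m → Bool) (i : Fin n) : Bool :=
    if h : i ∈ C.fixed then C.value i else y (e.symm ⟨i, h⟩)
  refine ⟨⟨⟨fun x => x.1 ∘ φ, fun y => ⟨extend y, fun i hi => dif_pos hi⟩,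
    fun x => Subtype.ext (funext fun i => ?_), fun y => funext fun k => ?_⟩, fun {x y} => ?_⟩⟩
  · by_cases hi : i ∈ C.fixed
    · simp [extend, hi, x.2 i hi]
    · simp [extend, hi, φ]
  · simp [extend, φ, (e k).2]
  · change hammingDist (x.1 ∘ φ) (y.1 ∘ φ) = 1 ↔ C.subgraph.Adj x y
    rw [hammingDist_comp_embedding φ fun i hi => (x.2 i (hφ i hi)).trans (y.2 i (hφ i hi)).symm]
    exact ⟨fun h => ⟨x.2, y.2, h⟩, fun h => h.2.2⟩

/-- The subcube fixed at the positions in `S` that contains the `j`-th neighbor of the zero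
string. -/
def neighborCube (S : Finset (Fin n)) (j : Fin n) : Subcube (Fin n) :=
  ⟨S, fun i => decide (i = j)⟩

variable {S J : Finset (Fin n)} {i j : Fin n} {x : Fin n → Bool}

theorem zero_notMem_neighborCube (hj : j ∈ S) : (fun _ => false) ∉ (neighborCube S j).points :=
  fun h => by simpa [neighborCube] using h j hj

theorem notMem_neighborCube_of_ne {a b : Fin n} (ha : a ∈ S) (hb : b ∈ S) (hab : a ≠ b)
    (hxa : x a = true) (hxb : x b = true) : x ∉ (neighborCube S j).points := by
  intro h
  have haj : a = j := by simpa [neighborCube, hxa] using h a ha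
  have hbj : b = j := by simpa [neighborCube, hxb] using h b hb
  exact hab (haj.trans hbj.symm)

theorem eq_of_mem_neighborCube {k : Fin n} (hj : j ∈ S) (hxj : x ∈ (neighborCube S j).points)
    (hxk : x ∈ (neighborCube S k).points) : j = k := by
  simpa [neighborCube] using (hxj j hj).symm.trans (hxk j hj)

theorem toggle_mem_neighborCube {k : Fin n} (hx : ∀ k ∈ S, x k = false) (hk : k ∈ S)
    (hxk : toggle x i k = true) : i ∈ S ∧ toggle x i ∈ (neighborCube S i).points := by
  obtain rfl : k = i := by
    by_contra hki
    simp [toggle_of_ne x hki, hx k hk] at hxk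
  refine ⟨hk, fun l hl => ?_⟩
  rcases eq_or_ne l k with rfl | hlk
  · simpa [neighborCube] using hxk
  · simp [neighborCube, toggle_of_ne x hlk, hx l hl, hlk]

open Classical in
/-- The neighbor cubes fixed at `S` in the directions from `J`, as subgraphs of the hypercube. With
`J = S` they separate the zero string from the all-ones string; with `J = S.erase j` the only way
to leave the slice of strings vanishing on `S` is in direction `j`. -/
noncomputable def neighborFamily (S J : Finset (Fin n)) : Finset (hypercube n).Subgraph :=
  J.image fun j => (neighborCube S j).subgraph

theorem card_neighborFamily_le : (neighborFamily S J).card ≤ J.card := by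
  classical exact Finset.card_image_le

theorem forall_notMem_neighborFamily_iff :
    (∀ H ∈ neighborFamily S J, x ∉ H.verts) ↔ ∀ j ∈ J, x ∉ (neighborCube S j).points := by
  classical exact Finset.forall_mem_image

theorem isStructureFamily_neighborFamily (hS : S.card + m = n) (hJ : J ⊆ S) :
    IsStructureFamily (hypercube n) (hypercube m) (neighborFamily S J) := by
  classical
  simp only [IsStructureFamily, neighborFamily, Finset.forall_mem_image]
  refine ⟨fun j _ => (neighborCube S j).nonempty_iso hS, fun j hj k _ hne => ?_⟩
  refine Set.disjoint_left.2 fun x hxj hxk => hne ?_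
  rw [eq_of_mem_neighborCube (hJ hj) hxj hxk]

theorem not_preconnected_remove_neighborFamily (hS : 2 ≤ S.card) :
    ¬ (remove (hypercube n) (neighborFamily S S)).Preconnected := by
  intro h
  obtain ⟨a, ha, b, hb, hab⟩ := Finset.one_lt_card.1 hS
  have hzero : ∀ H ∈ neighborFamily S S, (fun _ => false) ∉ H.verts :=
    forall_notMem_neighborFamily_iff.2 fun j hj => zero_notMem_neighborCube hj
  have hone : ∀ H ∈ neighborFamily S S, (fun _ => true) ∉ H.verts :=
    forall_notMem_neighborFamily_iff.2 fun j _ => notMem_neighborCube_of_ne ha hb hab rfl rfl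
  obtain ⟨p⟩ := h ⟨_, hzero⟩ ⟨_, hone⟩
  obtain ⟨⟨⟨x, y⟩, hxy⟩, -, hx, hy⟩ := p.exists_boundary_dart {x | ∀ k ∈ S, x.1 k = false}
    (fun _ _ => rfl) fun hvanish => by simpa using hvanish a ha
  obtain ⟨i, hi⟩ : ∃ i, y.1 = toggle x.1 i := hypercube_adj_iff.1 hxy
  obtain ⟨k, hk, hyk⟩ : ∃ k ∈ S, y.1 k = true := by simpa using hy
  obtain ⟨hiS, hmem⟩ := toggle_mem_neighborCube hx hk (hi ▸ hyk)
  exact forall_notMem_neighborFamily_iff.1 y.2 i hiS (hi ▸ hmem)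

end NeighborCubes

section LowerBound

theorem le_edist_of_forall_adj_le_succ {V : Type*} {G : SimpleGraph V} {f : V → ℕ}
    (hf : ∀ x y, G.Adj x y → f y ≤ f x + 1) {u v : V} {L : ℕ} (h : f u + L ≤ f v) :
    L ≤ G.edist u v := by
  refine le_iInf fun p => ?_
  have hlength : f v ≤ f u + p.length := by
    clear h
    induction p with
    | nil => simp
    | cons huv p ih =>
      have := hf _ _ huv
      rw [SimpleGraph.Walk.length_cons]
      omega
  exact_mod_cast Nat.le_of_add_le_add_left (h.trans hlength)

variable {n : ℕ}

theorem le_ediam_remove_empty : n ≤ (remove (hypercube n) ∅).ediam := by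
  let o : Fin n → Bool := fun _ => false
  refine (le_edist_of_forall_adj_le_succ (f := fun x => hammingDist x.1 o) (fun x y hxy => ?_)
    ?_).trans (SimpleGraph.edist_le_ediam (u := ⟨o, by simp⟩) (v := ⟨fun _ => true, by simp⟩))
  · have hyx : hammingDist y.1 x.1 = 1 := hxy.symm
    have := hammingDist_triangle y.1 x.1 o
    omega
  · simp [o, hammingDist]

/-- The distance from the zero string, corrected by the detour that is forced when the slice of
strings vanishing on `S` can be left in direction `j` only. -/
def detourPotential (S : Finset (Fin n)) (j : Fin n) (x : Fin n → Bool) : ℕ :=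
  hammingDist x (fun _ => false) + if x j = false ∧ ∃ i ∈ S, x i = true then 2 else 0

variable {S : Finset (Fin n)} {j : Fin n}

theorem detourPotential_le_succ {x y : Fin n → Bool} (hxy : (hypercube n).Adj x y)
    (hy : ∀ i ∈ S.erase j, y ∉ (neighborCube S i).points) :
    detourPotential S j y ≤ detourPotential S j x + 1 := by
  obtain ⟨i, rfl⟩ := hypercube_adj_iff.1 hxy
  cases hxi : x i with
  | true =>
    have := hammingDist_toggle_add_one (x := x) (y := fun _ => false) (i := i) (by simp [hxi])
    unfold detourPotential
    split_ifs <;> omega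
  | false =>
    have hdist := hammingDist_toggle_add_one (x := toggle x i) (y := fun _ => false) (i := i)
      (by simp [hxi])
    rw [toggle_toggle] at hdist
    have hdetour : (toggle x i j = false ∧ ∃ k ∈ S, toggle x i k = true) →
        x j = false ∧ ∃ k ∈ S, x k = true := by
      rintro ⟨hj, k, hk, hxk⟩
      have hji : j ≠ i := fun hji => by simp [hji, hxi] at hj
      refine ⟨toggle_of_ne x hji ▸ hj, ?_⟩
      by_contra! hx
      obtain ⟨hiS, hmem⟩ := toggle_mem_neighborCube (by simpa using hx) hk hxk
      exact hy i (Finset.mem_erase.2 ⟨hji.symm, hiS⟩) hmem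
    unfold detourPotential
    split_ifs with hy' hx'
    case neg => exact absurd (hdetour hy') hx'
    all_goals omega

theorem succ_le_ediam_remove_neighborFamily (hj : j ∈ S) (hS : 3 ≤ S.card) :
    (n + 1 : ℕ) ≤ (remove (hypercube n) (neighborFamily S (S.erase j))).ediam := by
  obtain ⟨a, ha, b, hb, hab⟩ : ∃ a ∈ S.erase j, ∃ b ∈ S.erase j, a ≠ b :=
    Finset.one_lt_card.1 (by rw [Finset.card_erase_of_mem hj]; omega)
  obtain ⟨haj, haS⟩ := Finset.mem_erase.1 ha
  obtain ⟨hbj, hbS⟩ := Finset.mem_erase.1 hb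
  let o : Fin n → Bool := fun _ => false
  let v : Fin n → Bool := toggle (fun _ => true) j
  have hva : v a = true := toggle_of_ne _ haj
  have hvb : v b = true := toggle_of_ne _ hbj
  have ho : ∀ H ∈ neighborFamily S (S.erase j), o ∉ H.verts :=
    forall_notMem_neighborFamily_iff.2 fun i hi =>
      zero_notMem_neighborCube (Finset.mem_of_mem_erase hi)
  have hv : ∀ H ∈ neighborFamily S (S.erase j), v ∉ H.verts :=
    forall_notMem_neighborFamily_iff.2 fun i _ => notMem_neighborCube_of_ne haS hbS hab hva hvb
  have hpo : detourPotential S j o = 0 := by simp [detourPotential, o]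
  have hpv : detourPotential S j v = n + 1 := by
    have hdist : hammingDist v o + 1 = n :=
      (hammingDist_toggle_add_one (by simp [o])).trans (by simp [o, hammingDist])
    rw [detourPotential, if_pos ⟨by simp [v], a, haS, hva⟩]
    exact congrArg (· + 1) hdist
  refine (le_edist_of_forall_adj_le_succ (f := fun x => detourPotential S j x.1)
    (fun x y hxy => detourPotential_le_succ hxy (forall_notMem_neighborFamily_iff.1 y.2))
    ?_).trans (SimpleGraph.edist_le_ediam (u := ⟨o, ho⟩) (v := ⟨v, hv⟩))
  simp only [hpo, hpv, zero_add, le_refl]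

end LowerBound

section Main

variable {n m : ℕ}

theorem exists_card_add_eq (h : m ≤ n) : ∃ S : Finset (Fin n), S.card + m = n := by
  obtain ⟨S, -, hS⟩ := Finset.exists_subset_card_eq (s := (Finset.univ : Finset (Fin n)))
    (n := n - m) (by simp)
  exact ⟨S, by omega⟩

theorem structureConnectivity_hypercube (hm : m + 2 ≤ n) :
    structureConnectivity (hypercube n) (hypercube m) = (n - m : ℕ) := by
  refine le_antisymm ?_ (le_iInf₂ fun F hF => ?_)
  · obtain ⟨S, hS⟩ := exists_card_add_eq (m := m) (n := n) (by omega)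
    refine (iInf₂_le (neighborFamily S S) ⟨isStructureFamily_neighborFamily hS subset_rfl,
      not_preconnected_remove_neighborFamily (by omega)⟩).trans ?_
    exact_mod_cast card_neighborFamily_le.trans (by omega)
  · by_contra! hlt
    have hcard : F.card < n - m := by exact_mod_cast hlt
    exact hF.2 (SimpleGraph.preconnected_of_ediam_ne_top
      (ne_top_of_le_ne_top (ENat.natCast_ne_top _) (ediam_remove_le_succ hF.1.1 (by omega))))

theorem card_add_one_le_structureConnectivity_iff (hm : m + 2 ≤ n)
    {F : Finset (hypercube n).Subgraph} :
    F.card + 1 ≤ structureConnectivity (hypercube n) (hypercube m) ↔ F.card + m < n := by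
  rw [structureConnectivity_hypercube hm]
  norm_cast
  omega

theorem structureFaultDiameter_hypercube_add_two (hn : n = m + 2) :
    structureFaultDiameter (hypercube n) (hypercube m) = n := by
  refine le_antisymm (iSup₂_le fun F hF => ?_) (le_ediam_remove_empty.trans (le_iSup₂_of_le ∅ ?_
    le_rfl))
  · have := (card_add_one_le_structureConnectivity_iff hn.ge).1 hF.2
    exact ediam_remove_le_of_card_le_one hF.1.1 (by omega)
  · exact ⟨⟨by simp, by simp⟩, (card_add_one_le_structureConnectivity_iff hn.ge).2 (by simp; omega)⟩

theorem structureFaultDiameter_hypercube_of_add_three_le (hm : m + 3 ≤ n) :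
    structureFaultDiameter (hypercube n) (hypercube m) = n + 1 := by
  have hiff {F : Finset (hypercube n).Subgraph} :=
    card_add_one_le_structureConnectivity_iff (m := m) (n := n) (F := F) (by omega)
  refine le_antisymm (iSup₂_le fun F hF => ediam_remove_le_succ hF.1.1 (hiff.1 hF.2)) ?_
  obtain ⟨S, hS⟩ := exists_card_add_eq (m := m) (n := n) (by omega)
  obtain ⟨j, hj⟩ : S.Nonempty := Finset.card_pos.1 (by omega)
  have hcard : (neighborFamily S (S.erase j)).card + m < n := by
    have := (card_neighborFamily_le (S := S)).trans_lt (Finset.card_erase_lt_of_mem hj)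
    omega
  exact (succ_le_ediam_remove_neighborFamily hj (by omega)).trans (le_iSup₂_of_le _
    ⟨isStructureFamily_neighborFamily hS (Finset.erase_subset j S), hiff.2 hcard⟩ le_rfl)

end Main

end StructureFault

theorem theorem3p26 (n m : ℕ) (hn : 3 ≤ n) (hm : m + 2 ≤ n) :
    (n = m + 2 →
      StructureFault.structureFaultDiameter
        (StructureFault.hypercube n) (StructureFault.hypercube m) = (n : ℕ∞)) ∧
    (m + 3 ≤ n →
      StructureFault.structureFaultDiameter
        (StructureFault.hypercube n) (StructureFault.hypercube m) = (n : ℕ∞) + 1) :=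
  ⟨StructureFault.structureFaultDiameter_hypercube_add_two,
    StructureFault.structureFaultDiameter_hypercube_of_add_three_le⟩
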